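/- Let $\mathrm{FI}$ be the category of finite sets and injections, and $\mathrm{OI}$ (also written $\mathrm{FI}^O$) the category of totally ordered finite sets and order-preserving injections; put $[n]=\{1,\dots,n\}$. Let $\mathcal C$ be one of these two categories and let $K$ be a commutative ring. A $\mathcal C$-algebra over $K$ is a functor $\mathbf A$ from $\mathcal C$ to commutative $K$-algebras with $\mathbf A_\emptyset=K$. A module over $\mathbf A$ is a functor $\mathbf M$ from $\mathcal C$ to $K$-modules such that each $\mathbf M_S$ is an $\mathbf A_S$-module and the maps $\varepsilon^*$ are compatible with the multiplications. A submodule is generated by $G\subseteq\coprod_{n\ge 0}\mathbf M_{[n]}$ if it is the smallest submodule containing $G$; $\mathbf A$ is noetherian if every submodule (ideal) of $\mathbf A$, as a module over itself, is generated by a finite set. For $d\ge 1$ let $\mathbf X^{O,d}$ be the $\mathrm{OI}$-algebra with $\mathbf X^{O,d}_S=K[x_\pi : \pi\in\mathrm{Hom}_{\mathrm{OI}}([d],S)]$ and $\varepsilon^*(x_\pi)=x_{\varepsilon\circ\pi}$, and let $\mathbf X^{I,d}$ be the $\mathrm{FI}$-algebra defined in the same way with $\mathrm{Hom}_{\mathrm{FI}}$;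 let $\mathbf X^{O,0}$ and $\mathbf X^{I,0}$ be the constant algebras with value $K$. **Proposition.** Let $K$ be a field. (a) For every integer $d\ge 0$, $\mathbf X^{O,d}$ is noetherian if and only if $d\in\{0,1\}$. (b) For every integer $d\ge 0$, $\mathbf X^{I,d}$ is noetherian if and only if $d\in\{0,1\}$. (c) Let $d\ge 2$. For $i\ge 3$ and $1\le a<b\le i$ write $x_{a,b}$ for the variable of $\mathbf X^{O,d}_{[i+d-2]}$ (respectively $\mathbf X^{I,d}_{[i+d-2]}$) indexed by the order-preserving injection $[d]\to[i+d-2]$ with values $a,b,i+1,i+2,\dots,i+d-2$ (for $d=2$: with values $a,b$), and let $u_i=x_{1,2}x_{2,3}\cdots x_{i-1,i}\,x_{1,i}$. Then, in $\mathbf X^{O,d}$ as well as in $\mathbf X^{I,d}$, the ideals generated by these monomials form a strictly increasing chain $$\langle u_3\rangle\subsetneq\langle u_3,u_4\rangle\subsetneq\langle u_3,u_4,u_5\rangle\subsetneq\cdots.$$ -/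

import Mathlib

open CategoryTheory

namespace FIOI

universe u

/-! ### The categories `FI` and `OI` -/

/-- Objects of `FI`: finite sets. -/
structure FI : Type 1 where
  carrier : Type
  [finite : Finite carrier]

/-- Morphisms of `FI`: injective maps. -/
instance : Category FI where
  Hom S T := S.carrier ↪ T.carrier
  id S := Function.Embedding.refl S.carrier
  comp f g := Function.Embedding.trans f g

/-- Objects of `OI`: totally ordered finite sets. -/
structure OI : Type 1 where
  carrier : Type
  [linearOrder : LinearOrder carrier]
  [finite : Finite carrier]

attribute [instance] FI.finite OI.linearOrder OI.finite

/-- Morphisms of `OI`: order-preserving injective maps. -/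
instance : Category OI where
  Hom S T := S.carrier ↪o T.carrier
  id S := RelEmbedding.refl _
  comp f g := RelEmbedding.trans f g

/-- A category with distinguished objects `[0], [1], [2], …`, where `[0]` receives no morphism from
`[d]` for `d ≠ 0`. It is used only for `FI` and `OI`, in order to treat both at once. -/
class HasStd (C : Type 1) [Category.{0} C] where
  std : ℕ → C
  isEmpty_hom_zero : ∀ d : ℕ, d ≠ 0 → IsEmpty (std d ⟶ std 0)

/-- The object `[n]`. -/
abbrev std {C : Type 1} [Category.{0} C] [HasStd C] (n : ℕ) : C := HasStd.std n

instance : HasStd FI where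
  std n := ⟨Fin n⟩
  isEmpty_hom_zero d hd :=
    ⟨fun f : Fin d ↪ Fin 0 => (f ⟨0, Nat.pos_of_ne_zero hd⟩).elim0⟩

instance : HasStd OI where
  std n := ⟨Fin n⟩
  isEmpty_hom_zero d hd :=
    ⟨fun f : Fin d ↪o Fin 0 => (f ⟨0, Nat.pos_of_ne_zero hd⟩).elim0⟩

/-! ### Algebras and modules -/

section

variable (K : Type u) [CommRing K] (C : Type 1) [Category.{0} C] [HasStd C]

/-- A `C`-algebra over `K` (for `C = FI` or `C = OI`): a functor `A` from `C` to commutative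
`K`-algebras such that `A(∅) = K`. -/
structure Alg where
  toFunctor : C ⥤ CommAlgCat.{u} K
  bijective_algebraMap_zero : Function.Bijective (algebraMap K (toFunctor.obj (std 0)))

end

variable {K : Type u} [CommRing K] {C : Type 1} [Category.{0} C] [HasStd C]

/-- A `C`-module over the `C`-algebra `A`: a functor `M` from `C` to `K`-modules such that each
`M_S` is an `A_S`-module (compatibly with its structure of a `K`-module), and
`ε^*(a • m) = ε^*(a) • ε^*(m)` for every morphism `ε`. -/
structure Mod (A : Alg K C) where
  toFunctor : C ⥤ ModuleCat.{u} K
  [module : ∀ S : C, Module (A.toFunctor.obj S) (toFunctor.obj S)]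
  [isScalarTower : ∀ S : C, IsScalarTower K (A.toFunctor.obj S) (toFunctor.obj S)]
  map_smul' : ∀ {S T : C} (ε : S ⟶ T) (a : A.toFunctor.obj S) (m : toFunctor.obj S),
    (toFunctor.map ε).hom (a • m) = (A.toFunctor.map ε).hom a • (toFunctor.map ε).hom m

attribute [instance] Mod.module Mod.isScalarTower

/-- The functor to `K`-modules underlying `A`. -/
def Alg.moduleFunctor (A : Alg K C) : C ⥤ ModuleCat.{u} K where
  obj S := ModuleCat.of K (A.toFunctor.obj S)
  map ε := ModuleCat.ofHom (A.toFunctor.map ε).hom.toLinearMap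
  map_id S := by
    ext x
    change (A.toFunctor.map (𝟙 S)).hom x = x
    simp
  map_comp ε δ := by
    ext x
    change (A.toFunctor.map (ε ≫ δ)).hom x
      = (A.toFunctor.map δ).hom ((A.toFunctor.map ε).hom x)
    simp

/-- `A` as a module over itself: `A_S` acts on `A_S` by multiplication. -/
def Alg.regular (A : Alg K C) : Mod A where
  toFunctor := A.moduleFunctor
  module S := (Semiring.toModule : Module (A.toFunctor.obj S) (A.toFunctor.obj S))
  isScalarTower S :=
    (IsScalarTower.right : IsScalarTower K (A.toFunctor.obj S) (A.toFunctor.obj S))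
  map_smul' ε a m := map_mul (A.toFunctor.map ε).hom a m

/-- A submodule of `M`: a family of `A_S`-submodules `N_S` of `M_S` that is stable under all the
maps `ε^*`. -/
@[ext] structure Submod {A : Alg K C} (M : Mod A) where
  obj : ∀ S : C, Submodule (A.toFunctor.obj S) (M.toFunctor.obj S)
  map_mem : ∀ {S T : C} (ε : S ⟶ T) (m : M.toFunctor.obj S),
    m ∈ obj S → (M.toFunctor.map ε).hom m ∈ obj T

/-- Submodules are ordered by pointwise inclusion. -/
instance {A : Alg K C} (M : Mod A) : PartialOrder (Submod M) :=
  PartialOrder.lift Submod.obj fun _ _ h => Submod.ext h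

/-- The disjoint union of the `M_n = M_{[n]}` for `n ≥ 0`. -/
abbrev Mod.Elt {A : Alg K C} (M : Mod A) : Type u :=
  Σ n : ℕ, M.toFunctor.obj (std n)

/-- The subset `G` of `∐ M_n` is contained in the submodule `N`. -/
def Submod.Contains {A : Alg K C} {M : Mod A} (N : Submod M) (G : Set M.Elt) : Prop :=
  ∀ g ∈ G, g.2 ∈ N.obj (std g.1)

/-- The submodule generated by a subset `G` of `∐ M_n`: its value at `S` is the `A_S`-submodule
generated by all `ε^*(q)` with `q ∈ G ∩ M_n` and `ε : [n] ⟶ S`. -/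
def Mod.span {A : Alg K C} (M : Mod A) (G : Set M.Elt) : Submod M where
  obj S := Submodule.span (A.toFunctor.obj S)
    {x | ∃ g ∈ G, ∃ ε : std g.1 ⟶ S, x = (M.toFunctor.map ε).hom g.2}
  map_mem {S T} ε m hm := by
    induction hm using Submodule.span_induction with
    | mem x hx =>
      obtain ⟨g, hg, δ, rfl⟩ := hx
      exact Submodule.subset_span ⟨g, hg, δ ≫ ε, by simp⟩
    | zero => simp
    | add x y _ _ hx hy => rw [map_add]; exact add_mem hx hy
    | smul a x _ hx => rw [M.map_smul']; exact Submodule.smul_mem _ _ hx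

theorem Mod.span_contains {A : Alg K C} (M : Mod A) (G : Set M.Elt) :
    (M.span G).Contains G :=
  fun g hg => Submodule.subset_span ⟨g, hg, 𝟙 _, by simp⟩

/-- `M.span G` is the smallest submodule of `M` that contains `G`. -/
theorem Mod.span_le_iff {A : Alg K C} (M : Mod A) (G : Set M.Elt) (N : Submod M) :
    M.span G ≤ N ↔ N.Contains G := by
  constructor
  · intro h g hg
    exact h (std g.1) (M.span_contains G g hg)
  · intro h S
    refine Submodule.span_le.2 ?_
    rintro x ⟨g, hg, ε, rfl⟩
    exact N.map_mem ε g.2 (h g hg)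

/-- A submodule is finitely generated if it is generated by a finite subset of `∐ M_n`. -/
def Submod.IsFinitelyGenerated {A : Alg K C} {M : Mod A} (N : Submod M) : Prop :=
  ∃ G : Set M.Elt, G.Finite ∧ M.span G = N

/-- A module is noetherian if all its submodules are finitely generated. -/
def Mod.IsNoetherian {A : Alg K C} (M : Mod A) : Prop :=
  ∀ N : Submod M, N.IsFinitelyGenerated

/-- An algebra is noetherian if it is a noetherian module over itself. -/
def Alg.IsNoetherian (A : Alg K C) : Prop :=
  A.regular.IsNoetherian

/-! ### The algebras `X^{O,d}` and `X^{I,d}` -/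

/-- The index set of the variables `x_π` of `X^d_S`: the morphisms `π : [d] ⟶ S` if `d ≥ 1`.
If `d = 0` there are no variables, so that `X^0` is the constant algebra `K`. -/
def Var (d : ℕ) (S : C) : Type :=
  {_π : (std d : C) ⟶ S // d ≠ 0}

/-- `x_π ↦ x_{ε ∘ π}` on index sets. -/
def Var.map {d : ℕ} {S T : C} (ε : S ⟶ T) (v : Var d S) : Var d T :=
  ⟨v.1 ≫ ε, v.2⟩

variable (K C) in
/-- The `C`-algebra `X^d` over `K`: `X^d_S = K[x_π : π ∈ Hom([d], S)]` for `d ≥ 1`, with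
`ε^*(x_π) = x_{ε ∘ π}`, and `X^0_S = K`. It is `X^{O,d}` for `C = OI` and `X^{I,d}` for
`C = FI`. -/
noncomputable def X (d : ℕ) : Alg K C where
  toFunctor :=
    { obj := fun S => CommAlgCat.of K (MvPolynomial (Var d S) K)
      map := fun ε => CommAlgCat.ofHom (MvPolynomial.rename (Var.map ε))
      map_id := fun S => by
        refine CommAlgCat.hom_ext (MvPolynomial.algHom_ext fun v => ?_)
        have h : Var.map (𝟙 S) v = v := Subtype.ext (Category.comp_id v.1)
        simp [h]
      map_comp := fun ε δ => by
        refine CommAlgCat.hom_ext (MvPolynomial.algHom_ext fun v => ?_)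
        have h : Var.map (ε ≫ δ) v = Var.map δ (Var.map ε v) :=
          Subtype.ext (Category.assoc v.1 ε δ).symm
        simp [h] }
  bijective_algebraMap_zero := by
    have : IsEmpty (Var d (std 0 : C)) :=
      ⟨fun v => (HasStd.isEmpty_hom_zero d v.2).false v.1⟩
    exact (MvPolynomial.isEmptyAlgEquiv K (Var d (std 0 : C))).symm.bijective

/-! ### Cycle monomials -/

/-- For `a < b < m`, the order-preserving injection `[e + 2] → [m + e]` with image
`a < b < m < m + 1 < ⋯ < m + e - 1` (the elements of `[n]` being numbered from `0`). -/
def edge (e m a b : ℕ) (hab : a < b) (hbm : b < m) : Fin (e + 2) ↪o Fin (m + e) :=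
  OrderEmbedding.ofStrictMono
    (fun k => ⟨if k.1 = 0 then a else if k.1 = 1 then b else m + (k.1 - 2), by
      have := k.2
      split_ifs <;> omega⟩)
    (by
      intro k l hkl
      have hkl' : k.1 < l.1 := hkl
      rw [Fin.mk_lt_mk]
      split_ifs <;> omega)

/-- The cycle monomial `x_{1,2} x_{2,3} ⋯ x_{m-1,m} x_{1,m}` on `m = i + 3` vertices, for variables
`x_{a,b} = x_{edge a b}` given in an arbitrary commutative ring. -/
noncomputable def cycleProd {R : Type u} [CommRing R] (i : ℕ)
    (x : ∀ a b : ℕ, a < b → b < i + 3 → R) : R :=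
  (∏ j : Fin (i + 2), x j.1 (j.1 + 1) (Nat.lt_succ_self _) (by have := j.2; omega)) *
    x 0 (i + 2) (by omega) (by omega)

variable (K) in
/-- The cycle monomial on `i + 3` vertices in `X^{O,e+2}_{[i+3+e]}`. -/
noncomputable def cycleOI (e i : ℕ) : (X K OI (e + 2)).regular.Elt :=
  ⟨i + 3 + e, cycleProd (R := MvPolynomial (Var (e + 2) (std (i + 3 + e) : OI)) K) i
    fun a b hab hb =>
      MvPolynomial.X ⟨(edge e (i + 3) a b hab hb : Fin (e + 2) ↪o Fin (i + 3 + e)), by omega⟩⟩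

variable (K) in
/-- The cycle monomial on `i + 3` vertices in `X^{I,e+2}_{[i+3+e]}`. -/
noncomputable def cycleFI (e i : ℕ) : (X K FI (e + 2)).regular.Elt :=
  ⟨i + 3 + e, cycleProd (R := MvPolynomial (Var (e + 2) (std (i + 3 + e) : FI)) K) i
    fun a b hab hb =>
      MvPolynomial.X ⟨((edge e (i + 3) a b hab hb).toEmbedding : Fin (e + 2) ↪ Fin (i + 3 + e)),
        by omega⟩⟩

end FIOI

/-!
Both categories are treated at once: all that matters is that every object is isomorphic to some
`[n]`, that morphisms between the `[n]` are certain maps, and that all order embeddings are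
morphisms (`FIOI.StdConcrete`).

A nonzero ideal of the constant algebra `X^0` is generated by any nonzero element over `[n]` for
the least possible `n`, since such an element is a unit. For `X^1`, an ideal is a family of
ideals `I_n` of `K[x_1, …, x_n]` which is stable at least under renaming variables along order embeddings. Such renamings preserve
the lexicographic order, hence commute with taking leading monomials (`FIOI.lex_degree_rename`).
A monomial in `x_1, …, x_n` is a word of length `n` in the well-quasi-ordered set `ℕ`, and by
Higman's lemma divisibility up to order-preserving renaming is a well-quasi-order
(`FIOI.wellQuasiOrdered_mapDomain_le`). So there are finitely many elements such
that every leading monomial is divisible, up to renaming, by one of theirs; division with remainder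
shows that they generate (`FIOI.exists_finite_forall_le_span_rename`).

For `d = e + 2`, each variable `x_π` is read as the directed edge `(π(0), π(1))`. Setting the
variables which are edges of the cycle on `i + 3` vertices to `1` and all others to `0` sends the
`i`-th cycle monomial to `1`. Every translate of the `j`-th one with `j ≠ i` goes to `0`, because
there is no map from the `j`-th to the `i`-th directed cycle: the path `0 → 1 → ⋯ → j + 2` can only
go to a path of consecutive numbers, whose ends are not joined by an edge unless `j = i`
(`FIOI.eq_of_isCycleEdge`). Hence no cycle monomial lies in the
ideal generated by the others (`FIOI.cycle_notMem_span`), the chain of ideals is strict, and its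
union is not finitely generated.
-/

open CategoryTheory

namespace FIOI

universe u

/-! ### Lexicographic leading monomials and order embeddings -/

section Lex

variable {σ τ : Type*} [LinearOrder σ] [LinearOrder τ]

theorem toLex_mapDomain_strictMono (ε : σ ↪o τ) :
    StrictMono fun a : Lex (σ →₀ ℕ) => toLex ((ofLex a).mapDomain ε) := by
  intro a b hab
  obtain ⟨i, hi, hlt⟩ := Finsupp.Lex.lt_iff.1 hab
  refine Finsupp.Lex.lt_iff.2 ⟨ε i, fun j hj => ?_, ?_⟩
  · by_cases h : j ∈ Set.range ε
    · obtain ⟨j, rfl⟩ := h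
      simpa [Finsupp.mapDomain_apply ε.injective] using hi j (ε.lt_iff_lt.1 hj)
    · simp [Finsupp.mapDomain_of_notMem_range _ _ h]
  · simpa [Finsupp.mapDomain_apply ε.injective] using hlt

variable [WellFoundedGT σ] [WellFoundedGT τ] {K : Type*} [CommRing K]

theorem lex_degree_rename (ε : σ ↪o τ) (f : MvPolynomial σ K) :
    MonomialOrder.lex.degree (MvPolynomial.rename ε f) =
      (MonomialOrder.lex.degree f).mapDomain ε := by
  classical
  rcases eq_or_ne f 0 with rfl | hf
  · simp
  apply MonomialOrder.lex.toSyn.injective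
  apply le_antisymm
  · refine MonomialOrder.lex.degree_le_iff.2 fun c hc => ?_
    rw [MvPolynomial.support_rename_of_injective ε.injective, Finset.mem_image] at hc
    obtain ⟨c, hc, rfl⟩ := hc
    exact (toLex_mapDomain_strictMono ε).monotone (MonomialOrder.lex.le_degree hc)
  · apply MonomialOrder.lex.le_degree
    rw [MvPolynomial.support_rename_of_injective ε.injective]
    exact Finset.mem_image_of_mem _ (MonomialOrder.lex.degree_mem_support hf)

end Lex

/-! ### Higman's lemma for exponent vectors -/

/-- Higman's lemma for the exponent vectors of monomials in `n` variables, `n` arbitrary, read as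
words of length `n` in `ℕ`: in every infinite sequence, some term divides a later one after an
order-preserving renaming of the variables. -/
theorem wellQuasiOrdered_mapDomain_le :
    WellQuasiOrdered fun a b : Σ n : ℕ, Fin n →₀ ℕ =>
      ∃ ε : Fin a.1 ↪o Fin b.1, a.2.mapDomain ε ≤ b.2 := by
  intro f
  have hN : (Set.univ : Set ℕ).PartiallyWellOrderedOn (· ≤ ·) := Set.IsPWO.of_linearOrder _
  obtain ⟨m, n, hmn, h⟩ :=
    (hN.partiallyWellOrderedOn_sublistForall₂ (· ≤ ·)).exists_lt
      (f := fun k => List.ofFn (f k).2) (fun _ _ _ => trivial)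
  refine ⟨m, n, hmn, ?_⟩
  obtain ⟨l, hl, hsub⟩ := List.sublistForall₂_iff.1 h
  obtain ⟨ε, hε⟩ := List.sublist_iff_exists_fin_orderEmbedding_get_eq.1 hsub
  have hlen : (f m).1 = l.length := by simpa using hl.length_eq
  let ε' : Fin (f m).1 ↪o Fin (f n).1 :=
    ((Fin.castOrderIso hlen).toOrderEmbedding.trans ε).trans
      (Fin.castOrderIso (by simp)).toOrderEmbedding
  refine ⟨ε', fun j => ?_⟩
  by_cases hj : j ∈ Set.range ε'
  · obtain ⟨i, rfl⟩ := hj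
    rw [Finsupp.mapDomain_apply ε'.injective]
    have h1 := hl.get (i := i.1) (by simp) (hlen ▸ i.2)
    have h2 := hε (Fin.cast hlen i)
    simp only [List.get_eq_getElem, List.getElem_ofFn] at h1 h2
    rw [show l[i.1]'(hlen ▸ i.2) = _ from h2] at h1
    exact h1
  · simp [Finsupp.mapDomain_of_notMem_range _ _ hj]

theorem exists_finset_of_wellQuasiOrdered {α : Type*} {r : α → α → Prop} (hr : WellQuasiOrdered r)
    (P : α → Prop) : ∃ s : Finset α, (∀ x ∈ s, P x) ∧ ∀ y, P y → ∃ x ∈ s, r x y := by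
  by_contra! h
  obtain ⟨f, -, hf⟩ := exists_seq_of_forall_finset_exists P (fun x y => ¬ r x y) h
  obtain ⟨m, n, hmn, hr⟩ := hr f
  exact hf m n hmn hr

/-! ### Gröbner bases of compatible families of ideals -/

/-- By Higman's lemma there are finitely many polynomials in the family such that every leading
monomial in the family is divisible, up to order-preserving renaming, by one of theirs. Their
renamings form a Gröbner basis of each ideal. -/
theorem exists_finite_forall_le_span_rename {K : Type u} [Field K]
    (I : ∀ n, Ideal (MvPolynomial (Fin n) K))
    (hI : ∀ {m n} (ε : Fin m ↪o Fin n) (f), f ∈ I m → MvPolynomial.rename ε f ∈ I n) :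
    ∃ G : Set (Σ n, MvPolynomial (Fin n) K), G.Finite ∧ (∀ g ∈ G, g.2 ∈ I g.1) ∧
      ∀ n, I n ≤ Ideal.span
        {f | ∃ g ∈ G, ∃ ε : Fin g.1 ↪o Fin n, f = MvPolynomial.rename ε g.2} := by
  let E : (Σ n, MvPolynomial (Fin n) K) → Σ n, Fin n →₀ ℕ :=
    fun f => ⟨f.1, MonomialOrder.lex.degree f.2⟩
  have hwqo : WellQuasiOrdered fun f g : Σ n, MvPolynomial (Fin n) K =>
      ∃ ε : Fin f.1 ↪o Fin g.1, (E f).2.mapDomain ε ≤ (E g).2 :=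
    fun s => wellQuasiOrdered_mapDomain_le (E ∘ s)
  obtain ⟨G, hG, hdiv⟩ := exists_finset_of_wellQuasiOrdered hwqo fun f => f.2 ∈ I f.1 ∧ f.2 ≠ 0
  refine ⟨G, G.finite_toSet, fun g hg => (hG g hg).1, fun n f hf => ?_⟩
  set B := {f | ∃ g ∈ (G : Set (Σ n, MvPolynomial (Fin n) K)), ∃ ε : Fin g.1 ↪o Fin n,
    f = MvPolynomial.rename ε g.2}
  have hB0 : ∀ b ∈ B, IsUnit (MonomialOrder.lex.leadingCoeff b) := by
    rintro _ ⟨g, hg, ε, rfl⟩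
    rw [isUnit_iff_ne_zero, MonomialOrder.leadingCoeff_ne_zero_iff]
    exact (map_ne_zero_iff _ (MvPolynomial.rename_injective _ ε.injective)).2 (hG g hg).2
  have hBI : Ideal.span B ≤ I n := by
    refine Ideal.span_le.2 ?_
    rintro _ ⟨g, hg, ε, rfl⟩
    exact hI ε _ (hG g hg).1
  obtain ⟨q, r, hqr, -, hr⟩ := MonomialOrder.lex.div_set hB0 f
  have hq : Finsupp.linearCombination _ (fun b : B => (b : MvPolynomial (Fin n) K)) q
      ∈ Ideal.span B := by
    have h := (Finsupp.mem_span_range_iff_exists_finsupp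
      (R := MvPolynomial (Fin n) K) (v := fun b : B => (b : MvPolynomial (Fin n) K))).2 ⟨q, rfl⟩
    rwa [Subtype.range_coe] at h
  have hr0 : r = 0 := by
    by_contra hr0
    have hrI : r ∈ I n := by
      rw [eq_sub_of_add_eq' hqr.symm]
      exact sub_mem hf (hBI hq)
    obtain ⟨g, hg, ε, hle⟩ := hdiv ⟨n, r⟩ ⟨hrI, hr0⟩
    refine hr _ (MonomialOrder.lex.degree_mem_support hr0) _ ⟨g, hg, ε, rfl⟩ ?_
    rw [lex_degree_rename]
    exact hle
  rw [hqr, hr0, add_zero]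
  exact hq

/-! ### Common features of `FI` and `OI` -/

/-- A category whose objects are isomorphic to the standard ones `[n]`, whose morphisms
`[m] ⟶ [n]` are certain maps `Fin m → Fin n`, and which has all order embeddings
`[m] ⟶ [n]` among its morphisms. Both `FI` and `OI` are of this kind. -/
class StdConcrete (C : Type 1) [Category.{0} C] [HasStd C] where
  /-- The map underlying a morphism. -/
  ev {m n : ℕ} : ((std m : C) ⟶ std n) → Fin m → Fin n
  ev_injective {m n : ℕ} : Function.Injective (ev : ((std m : C) ⟶ std n) → Fin m → Fin n)
  ev_comp {l m n : ℕ} (f : (std l : C) ⟶ std m) (g : (std m : C) ⟶ std n) (i : Fin l) :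
    ev (f ≫ g) i = ev g (ev f i)
  /-- The morphism given by an order embedding. -/
  ofEmb {m n : ℕ} : (Fin m ↪o Fin n) → ((std m : C) ⟶ std n)
  ev_ofEmb {m n : ℕ} (f : Fin m ↪o Fin n) (i : Fin m) : ev (ofEmb f) i = f i
  exists_iso (S : C) : ∃ n, Nonempty ((std n : C) ≅ S)

instance : StdConcrete FI where
  ev {m n} (f : Fin m ↪ Fin n) := f
  ev_injective {m n} :=
    (DFunLike.coe_injective : Function.Injective fun f : Fin m ↪ Fin n => ⇑f)
  ev_comp _ _ _ := rfl
  ofEmb f := f.toEmbedding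
  ev_ofEmb _ _ := rfl
  exists_iso S := by
    obtain ⟨n, ⟨e⟩⟩ := Finite.exists_equiv_fin S.carrier
    refine ⟨n, ⟨⟨e.symm.toEmbedding, e.toEmbedding, ?_, ?_⟩⟩⟩
    · exact Function.Embedding.ext fun x => e.apply_symm_apply x
    · exact Function.Embedding.ext fun x => e.symm_apply_apply x

instance : StdConcrete OI where
  ev {m n} (f : Fin m ↪o Fin n) := f
  ev_injective {m n} :=
    (DFunLike.coe_injective : Function.Injective fun f : Fin m ↪o Fin n => ⇑f)
  ev_comp _ _ _ := rfl
  ofEmb f := f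
  ev_ofEmb _ _ := rfl
  exists_iso S := by
    have := Fintype.ofFinite S.carrier
    let e := monoEquivOfFin S.carrier rfl
    refine ⟨_, ⟨⟨e.toOrderEmbedding, e.symm.toOrderEmbedding, ?_, ?_⟩⟩⟩
    · exact RelEmbedding.ext fun x => e.symm_apply_apply x
    · exact RelEmbedding.ext fun x => e.apply_symm_apply x

open StdConcrete

/-! ### Generalities on submodules -/

section Submodules

variable {K : Type u} [CommRing K] {C : Type 1} [Category.{0} C] [HasStd C]

theorem Mod.span_mono {A : Alg K C} (M : Mod A) {G H : Set M.Elt} (h : G ⊆ H) :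
    M.span G ≤ M.span H :=
  (M.span_le_iff G _).2 fun g hg => M.span_contains H g (h hg)

theorem Submod.le_of_forall_std [StdConcrete C] {A : Alg K C} {M : Mod A} {N N' : Submod M}
    (h : ∀ n, N.obj (std n) ≤ N'.obj (std n)) : N ≤ N' := by
  intro S x hx
  obtain ⟨n, ⟨e⟩⟩ := exists_iso S
  have := N'.map_mem e.hom _ (h n (N.map_mem e.inv x hx))
  rwa [← ModuleCat.comp_apply, ← Functor.map_comp, e.inv_hom_id, CategoryTheory.Functor.map_id,
    ModuleCat.id_apply] at this

theorem Mod.not_isNoetherian_of_strictMono_span {A : Alg K C} (M : Mod A) (G : ℕ → Set M.Elt)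
    (hG : Monotone G) (h : StrictMono fun n => M.span (G n)) : ¬ M.IsNoetherian := by
  intro hM
  obtain ⟨F, hF, hspan⟩ := hM (M.span (⋃ n, G n))
  have key : ∀ (S : C) (x), x ∈ (M.span (⋃ n, G n)).obj S → ∃ n, x ∈ (M.span (G n)).obj S := by
    intro S x hx
    induction hx using Submodule.span_induction with
    | mem x hx =>
      obtain ⟨g, hg, ε, rfl⟩ := hx
      obtain ⟨n, hn⟩ := Set.mem_iUnion.1 hg
      exact ⟨n, Submodule.subset_span ⟨g, hn, ε, rfl⟩⟩
    | zero => exact ⟨0, zero_mem _⟩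
    | add x y _ _ hx hy =>
      obtain ⟨m, hm⟩ := hx
      obtain ⟨n, hn⟩ := hy
      exact ⟨max m n, add_mem (M.span_mono (hG (le_max_left m n)) S hm)
        (M.span_mono (hG (le_max_right m n)) S hn)⟩
    | smul a x _ hx =>
      obtain ⟨n, hn⟩ := hx
      exact ⟨n, Submodule.smul_mem _ _ hn⟩
  have hex : ∀ g ∈ F, ∃ n, g.2 ∈ (M.span (G n)).obj (std g.1) := fun g hg =>
    key _ _ (hspan ▸ M.span_contains F g hg)
  choose! k hk using hex
  obtain ⟨b, hb⟩ := (hF.image k).bddAbove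
  have hle : M.span (⋃ n, G n) ≤ M.span (G b) := by
    rw [← hspan, M.span_le_iff]
    exact fun g hg => M.span_mono (hG (hb ⟨g, hg, rfl⟩)) _ (hk g hg)
  exact (h b.lt_succ_self).not_ge ((M.span_mono (Set.subset_iUnion G _)).trans hle)

/-- The value at `S` of a submodule of `X^d`, as an ideal of the polynomial ring `X^d_S`. -/
def Submod.ideal {d : ℕ} (N : Submod (X K C d).regular) (S : C) :
    Ideal (MvPolynomial (Var d S) K) :=
  N.obj S

theorem Submod.rename_mem_ideal {d : ℕ} (N : Submod (X K C d).regular) {S T : C} (ε : S ⟶ T)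
    {f : MvPolynomial (Var d S) K} (hf : f ∈ N.ideal S) :
    MvPolynomial.rename (Var.map ε) f ∈ N.ideal T :=
  N.map_mem ε f hf

theorem ideal_span {d : ℕ} (G : Set (Σ n, MvPolynomial (Var d (std n : C)) K)) (S : C) :
    Submod.ideal ((X K C d).regular.span G) S =
      Ideal.span {f | ∃ g ∈ G, ∃ ε : std g.1 ⟶ S, f = MvPolynomial.rename (Var.map ε) g.2} :=
  rfl

theorem Submod.isFinitelyGenerated_of_le_span [StdConcrete C] {d : ℕ}
    (N : Submod (X K C d).regular) (G : Set (Σ n, MvPolynomial (Var d (std n : C)) K))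
    (hG : G.Finite) (hGN : ∀ g ∈ G, g.2 ∈ N.ideal (std g.1))
    (h : ∀ n, N.ideal (std n) ≤
      Ideal.span {f | ∃ g ∈ G, ∃ ε : (std g.1 : C) ⟶ std n,
        f = MvPolynomial.rename (Var.map ε) g.2}) :
    N.IsFinitelyGenerated :=
  ⟨G, hG, le_antisymm ((Mod.span_le_iff _ _ _).2 hGN) (Submod.le_of_forall_std h)⟩

end Submodules

/-! ### The noetherian algebras `X^0` and `X^1` -/

section Noetherian

variable (K : Type u) [Field K] (C : Type 1) [Category.{0} C] [HasStd C] [StdConcrete C]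

/-- A nonzero ideal of the constant algebra `K` is zero on `[m]` for `m < n` and the unit ideal
from some `[n]` on, so one nonzero element over `[n]` generates it. -/
theorem isNoetherian_X_zero : (X K C 0).IsNoetherian := by
  classical
  intro N
  by_cases h : ∃ n, N.ideal (std n : C) ≠ ⊥
  · obtain ⟨g, hg, hg0⟩ := Submodule.exists_mem_ne_zero_of_ne_bot (Nat.find_spec h)
    refine N.isFinitelyGenerated_of_le_span {⟨Nat.find h, g⟩} (Set.finite_singleton _)
      (by rintro _ rfl; exact hg) fun m f hf => ?_
    rcases eq_or_ne f 0 with rfl | hf0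
    · exact zero_mem _
    have hle : Nat.find h ≤ m :=
      Nat.find_min' h fun hbot => hf0 (by rw [hbot] at hf; exact hf)
    have hempty : IsEmpty (Var 0 (std (Nat.find h) : C)) := ⟨fun v => v.2 rfl⟩
    have hunit : IsUnit g := by
      rw [← MulEquiv.isUnit_map (MvPolynomial.isEmptyAlgEquiv K (Var 0 (std (Nat.find h) : C))),
        isUnit_iff_ne_zero]
      exact (map_ne_zero_iff _ (MvPolynomial.isEmptyAlgEquiv K _).injective).2 hg0
    let ε : (std (Nat.find h) : C) ⟶ std m := ofEmb (Fin.castLEOrderEmb hle)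
    refine (Submodule.eq_top_iff'.1 (Ideal.eq_top_of_isUnit_mem _
      (x := MvPolynomial.rename (Var.map ε) g) (Ideal.subset_span ?_) (hunit.map _))) f
    exact ⟨⟨Nat.find h, g⟩, Set.mem_singleton _, ε, rfl⟩
  · push Not at h
    refine N.isFinitelyGenerated_of_le_span ∅ Set.finite_empty (by simp) fun m => ?_
    rw [h m]
    exact bot_le

variable {C}

/-- The variables of `X^1_{[n]}` are indexed by the elements of `[n]`. -/
def varOneEquiv (n : ℕ) : Fin n ≃ Var 1 (std n : C) where
  toFun i := ⟨ofEmb (OrderEmbedding.ofStrictMono (fun _ : Fin 1 => i) (Subsingleton.strictMono _)),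
    one_ne_zero⟩
  invFun v := ev v.1 0
  left_inv i := by simp [ev_ofEmb]
  right_inv v := by
    refine Subtype.ext (ev_injective (funext fun j => ?_))
    rw [ev_ofEmb, Subsingleton.elim j 0]
    rfl

theorem ev_varOneEquiv {n : ℕ} (i : Fin n) (j : Fin 1) :
    ev (varOneEquiv (C := C) n i).1 j = i :=
  ev_ofEmb _ _

theorem varMap_varOneEquiv {m n : ℕ} (ε : Fin m ↪o Fin n) (i : Fin m) :
    Var.map (ofEmb ε) (varOneEquiv (C := C) m i) = varOneEquiv n (ε i) := by
  refine Subtype.ext (ev_injective (funext fun j => ?_))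
  rw [Var.map, ev_comp, ev_ofEmb, ev_varOneEquiv, ev_varOneEquiv]

theorem rename_varMap_varOneEquiv {m n : ℕ} (ε : Fin m ↪o Fin n) (f : MvPolynomial (Fin m) K) :
    MvPolynomial.rename (Var.map (ofEmb ε)) (MvPolynomial.rename (varOneEquiv (C := C) m) f) =
      MvPolynomial.rename (varOneEquiv n) (MvPolynomial.rename ε f) := by
  simp only [MvPolynomial.rename_rename]
  congr 2
  exact funext (varMap_varOneEquiv ε)

variable (C)

theorem isNoetherian_X_one : (X K C 1).IsNoetherian := by
  intro N
  obtain ⟨G, hG, hGN, hspan⟩ := exists_finite_forall_le_span_rename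
    (fun n => (N.ideal (std n)).comap (MvPolynomial.rename (R := K) (varOneEquiv (C := C) n)))
    (fun {m n} ε f hf => by
      rw [Ideal.mem_comap, ← rename_varMap_varOneEquiv]
      exact N.rename_mem_ideal (ofEmb ε) hf)
  refine N.isFinitelyGenerated_of_le_span
    ((fun g => ⟨g.1, MvPolynomial.rename (varOneEquiv g.1) g.2⟩) '' G) (hG.image _)
    (by rintro _ ⟨g, hg, rfl⟩; exact hGN g hg) fun n f hf => ?_
  obtain ⟨f, rfl⟩ := (MvPolynomial.renameEquiv K (varOneEquiv (C := C) n)).surjective f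
  have hf' := hspan n hf
  rw [MvPolynomial.renameEquiv_apply, ← Ideal.mem_comap]
  refine Ideal.span_le.2 ?_ hf'
  rintro _ ⟨g, hg, ε, rfl⟩
  refine Ideal.subset_span ⟨_, ⟨g, hg, rfl⟩, ofEmb ε, ?_⟩
  exact (rename_varMap_varOneEquiv K ε g.2).symm

end Noetherian

/-! ### Cycle monomials -/

section Cycles

/-- The cycle graph on `0, …, i + 2`, with its edges directed upwards: `p → p + 1` and
`0 → i + 2`. -/
def IsCycleEdge (i p q : ℕ) : Prop :=
  (q = p + 1 ∧ q < i + 3) ∨ (p = 0 ∧ q = i + 2)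

/-- The edge `0 → i + 2` ends at a sink and starts at a source, so that a directed path of length
at least two consists of edges `p → p + 1`. -/
theorem eq_of_isCycleEdge {i j : ℕ} (f : ℕ → ℕ)
    (hpath : ∀ a < j + 2, IsCycleEdge i (f a) (f (a + 1)))
    (hlast : IsCycleEdge i (f 0) (f (j + 2))) : i = j := by
  simp only [IsCycleEdge] at hpath hlast
  have hstep : ∀ a < j + 2, f (a + 1) = f a + 1 := by
    intro a ha
    rcases hpath a ha with h | h
    · exact h.1
    rcases Nat.lt_or_ge (a + 1) (j + 2) with ha' | ha'
    · have := hpath (a + 1) ha'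
      omega
    · obtain ⟨b, rfl⟩ : ∃ b, a = b + 1 := ⟨a - 1, by omega⟩
      have := hpath b (by omega)
      omega
  have hf : ∀ a ≤ j + 2, f a = f 0 + a := by
    intro a
    induction a with
    | zero => simp
    | succ a ih =>
      intro ha
      rw [hstep a ha, ih (by omega), add_assoc]
  have := hf (j + 2) le_rfl
  omega

theorem map_cycleProd {R S : Type u} [CommRing R] [CommRing S] (φ : R →+* S) (i : ℕ)
    (x : ∀ a b : ℕ, a < b → b < i + 3 → R) :
    φ (cycleProd i x) = cycleProd i fun a b hab hb => φ (x a b hab hb) := by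
  simp [cycleProd]

variable (K : Type u) [Field K] (C : Type 1) [Category.{0} C] [HasStd C] [StdConcrete C]

/-- The cycle monomial on `i + 3` vertices, as a polynomial in the variables of
`X^{e+2}_{[i+3+e]}`. -/
noncomputable def cycleMonomial (e i : ℕ) :
    MvPolynomial (Var (e + 2) (std (i + 3 + e) : C)) K :=
  cycleProd i fun a b hab hb => MvPolynomial.X ⟨ofEmb (edge e (i + 3) a b hab hb), by omega⟩

/-- The cycle monomial on `i + 3` vertices, as an element of `∐ X^{e+2}_{[n]}`. -/
noncomputable def cycle (e i : ℕ) : (X K C (e + 2)).regular.Elt :=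
  ⟨i + 3 + e, cycleMonomial K C e i⟩

theorem cycle_OI (e i : ℕ) : cycle K OI e i = cycleOI K e i := rfl

theorem cycle_FI (e i : ℕ) : cycle K FI e i = cycleFI K e i := rfl

theorem eval_cycleMonomial (e i : ℕ) (p : Var (e + 2) (std (i + 3 + e) : C) → K) :
    MvPolynomial.eval p (cycleMonomial K C e i) =
      cycleProd i fun a b hab hb => p ⟨ofEmb (edge e (i + 3) a b hab hb), by omega⟩ := by
  rw [cycleMonomial, map_cycleProd]
  congr! with a b hab hb
  exact MvPolynomial.eval_X _

/-- The point of affine space whose coordinate at `x_π` is `1` if `(π(0), π(1))` is an edge of the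
cycle on `i + 3` vertices, and `0` otherwise. -/
noncomputable def cyclePoint (e i : ℕ) {n : ℕ} (v : Var (e + 2) (std n : C)) : K :=
  open Classical in if IsCycleEdge i (ev v.1 0) (ev v.1 1) then 1 else 0

theorem isCycleEdge_of_cyclePoint_ne_zero {e i n : ℕ} {v : Var (e + 2) (std n : C)}
    (h : cyclePoint K C e i v ≠ 0) : IsCycleEdge i (ev v.1 0) (ev v.1 1) := by
  by_contra hE
  exact h (if_neg hE)

theorem eval_cyclePoint_cycleMonomial (e i : ℕ) :
    MvPolynomial.eval (cyclePoint K C e i) (cycleMonomial K C e i) = 1 := by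
  have hedge : ∀ a b (hab : a < b) (hb : b < i + 3) h, IsCycleEdge i a b →
      cyclePoint K C e i ⟨ofEmb (edge e (i + 3) a b hab hb), h⟩ = 1 := by
    intro a b hab hb h hE
    refine if_pos ?_
    simpa [ev_ofEmb, edge] using hE
  rw [eval_cycleMonomial, cycleProd, Finset.prod_eq_one fun j _ => ?_, one_mul]
  · exact hedge _ _ _ _ _ (Or.inr ⟨rfl, rfl⟩)
  · exact hedge _ _ _ _ _ (Or.inl ⟨rfl, by omega⟩)

/-- If the value were nonzero, the underlying map of `ε` would carry the directed edges of the
cycle on `j + 3` vertices to edges of the cycle on `i + 3` vertices. -/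
theorem eval_cyclePoint_rename_cycleMonomial {e i j : ℕ} (hij : i ≠ j)
    (ε : (std (j + 3 + e) : C) ⟶ std (i + 3 + e)) :
    MvPolynomial.eval (cyclePoint K C e i)
      (MvPolynomial.rename (Var.map ε) (cycleMonomial K C e j)) = 0 := by
  by_contra hne
  rw [MvPolynomial.eval_rename, eval_cycleMonomial, cycleProd, mul_eq_zero, not_or,
    Finset.prod_eq_zero_iff] at hne
  obtain ⟨hpath, hlast⟩ := hne
  -- The value `0` outside the domain of `ε` is never used: the edges stay below `j + 3`.
  let f : ℕ → ℕ := fun a => if h : a < j + 3 + e then ev ε ⟨a, h⟩ else 0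
  have hedge : ∀ a b (hab : a < b) (hb : b < j + 3) h,
      cyclePoint K C e i (Var.map ε ⟨ofEmb (edge e (j + 3) a b hab hb), h⟩) ≠ 0 →
      IsCycleEdge i (f a) (f b) := by
    intro a b hab hb h hne
    have hE := isCycleEdge_of_cyclePoint_ne_zero K C hne
    simp only [Var.map, ev_comp, ev_ofEmb] at hE
    have ha' : a < j + 3 + e := by omega
    have hb' : b < j + 3 + e := by omega
    simpa [f, ha', hb', edge] using hE
  refine hij (eq_of_isCycleEdge f (fun a ha => ?_) (hedge _ _ _ _ _ hlast))
  exact hedge _ _ _ _ _ fun h => hpath ⟨⟨a, ha⟩, Finset.mem_univ _, h⟩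

/-- The ideal generated by the other cycle monomials vanishes at `cyclePoint K C e i`, while
`cycle K C e i` itself does not. -/
theorem cycle_notMem_span (e i : ℕ) (s : Set ℕ) (hs : i ∉ s) :
    (cycle K C e i).2 ∉
      ((X K C (e + 2)).regular.span {g | ∃ j ∈ s, g = cycle K C e j}).obj
        (std (cycle K C e i).1) := by
  intro hmem
  have hle : Submod.ideal ((X K C (e + 2)).regular.span {g | ∃ j ∈ s, g = cycle K C e j})
      (std (i + 3 + e)) ≤ RingHom.ker (MvPolynomial.eval (cyclePoint K C e i)) := by
    refine (ideal_span _ _).trans_le (Ideal.span_le.2 ?_)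
    rintro _ ⟨_, ⟨j, hj, rfl⟩, ε, rfl⟩
    exact eval_cyclePoint_rename_cycleMonomial K C (by rintro rfl; exact hs hj) ε
  exact one_ne_zero ((eval_cyclePoint_cycleMonomial K C e i).symm.trans (hle hmem))

theorem strictMono_span_cycle (e : ℕ) : StrictMono fun n : ℕ =>
    (X K C (e + 2)).regular.span {g | ∃ i ≤ n, g = cycle K C e i} := by
  refine strictMono_nat_of_lt_succ fun n => lt_iff_le_not_ge.2 ⟨?_, fun h => ?_⟩
  · refine Mod.span_mono _ ?_
    rintro _ ⟨i, hi, rfl⟩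
    exact ⟨i, hi.trans n.le_succ, rfl⟩
  · exact cycle_notMem_span K C e (n + 1) {i | i ≤ n} (by simp)
      (h _ (Mod.span_contains _ _ _ ⟨n + 1, le_rfl, rfl⟩))

theorem isNoetherian_X_iff (d : ℕ) : (X K C d).IsNoetherian ↔ d = 0 ∨ d = 1 := by
  constructor
  · intro h
    by_contra! hd
    obtain ⟨e, rfl⟩ : ∃ e, d = e + 2 := ⟨d - 2, by omega⟩
    refine Mod.not_isNoetherian_of_strictMono_span _ _ ?_ (strictMono_span_cycle K C e) h
    rintro m n hmn _ ⟨i, hi, rfl⟩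
    exact ⟨i, hi.trans hmn, rfl⟩
  · rintro (rfl | rfl)
    · exact isNoetherian_X_zero K C
    · exact isNoetherian_X_one K C

end Cycles

end FIOI

theorem mainTheorem10 (K : Type*) [Field K] :
    (∀ d : ℕ, (FIOI.X K FIOI.OI d).IsNoetherian ↔ d = 0 ∨ d = 1) ∧
    (∀ d : ℕ, (FIOI.X K FIOI.FI d).IsNoetherian ↔ d = 0 ∨ d = 1) ∧
    (∀ e : ℕ, StrictMono fun n : ℕ =>
      (FIOI.X K FIOI.OI (e + 2)).regular.span {g | ∃ i ≤ n, g = FIOI.cycleOI K e i}) ∧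
    (∀ e : ℕ, StrictMono fun n : ℕ =>
      (FIOI.X K FIOI.FI (e + 2)).regular.span {g | ∃ i ≤ n, g = FIOI.cycleFI K e i}) := by
  simp only [← FIOI.cycle_OI, ← FIOI.cycle_FI]
  exact ⟨FIOI.isNoetherian_X_iff K FIOI.OI, FIOI.isNoetherian_X_iff K FIOI.FI,
    FIOI.strictMono_span_cycle K FIOI.OI, FIOI.strictMono_span_cycle K FIOI.FI⟩
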